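/- Identify the algebra $\mathbb H_{\mathbb C}=\mathbb C\otimes_{\mathbb R}\mathbb H$ of complexified quaternions with the algebra of complex $2\times 2$ matrices $Z=\begin{pmatrix} z_{11}&z_{12}\\ z_{21}&z_{22}\end{pmatrix}$, the real quaternions $\mathbb H\subset\mathbb H_{\mathbb C}$ being the real span of $$e_0=1,\quad e_1=\begin{pmatrix}0&-i\\-i&0\end{pmatrix},\quad e_2=\begin{pmatrix}0&-1\\1&0\end{pmatrix},\quad e_3=\begin{pmatrix}-i&0\\0&i\end{pmatrix}.$$ Put $N(Z)=\det Z$, so that $N(x^0e_0+x^1e_1+x^2e_2+x^3e_3)=(x^0)^2+(x^1)^2+(x^2)^2+(x^3)^2$ on $\mathbb H$, and let $dZ^4=dz_{11}\wedge dz_{12}\wedge dz_{21}\wedge dz_{22}$. For $R>0$ let $U(2)_R=\{RZ\,;\ Z\in U(2)\}$, oriented by translating the orientation of the tangent space of $U(2)$ at $1$ (the skew-Hermitian matrices) in which $(-ie_0,e_1,e_2,e_3)$ is a positively oriented basis; that is, $(-iZe_0,Ze_1,Ze_2,Ze_3)$ is a positively oriented basis of the tangent space of $U(2)_R$ at $Z$.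 Then for every polynomial $F\in\mathbb C[z_{11},z_{12},z_{21},z_{22}]$ (with no differential condition imposed), every $R>0$ and every $W\in\mathbb H$ with $N(W)<R^2$, the $4$-form $\frac{F(Z)}{N(Z-W)^2}\,dZ^4$ is integrable over $U(2)_R$ and $$F(W)=\frac{i}{8\pi^3}\int_{Z\in U(2)_R}\frac{F(Z)}{N(Z-W)^2}\,dZ^4 .$$ -/

import Mathlib

open MeasureTheory Matrix
open scoped Quaternion

section Integration

variable {E : Type*} [NormedAddCommGroup E] [NormedSpace ℝ E]

/-- Let `S ⊆ E` be a `d`-dimensional submanifold whose orientation is given by a frame field `τ`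
(so `τ p` is a positively oriented basis of the tangent space of `S` at `p`).
`φ : D → S` is a positively oriented parametrization of `S` up to a null set: `D ⊆ ℝ^d` is open,
`φ` is `C¹` and injective on `D`, at every point of `D` the partial derivatives of `φ` arise
from the frame by a matrix of positive determinant, and the part of `S` that is not covered has
`d`-dimensional Hausdorff measure zero. -/
structure IsPositiveParametrization {d : ℕ} (S : Set E) (τ : E → Fin d → E)
    (D : Set (Fin d → ℝ)) (φ : (Fin d → ℝ) → E) : Prop where
  isOpen : IsOpen D
  contDiffOn : ContDiffOn ℝ 1 φ D
  injOn : Set.InjOn φ D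
  mapsTo : Set.MapsTo φ D S
  positive : ∀ y ∈ D, ∃ A : Matrix (Fin d) (Fin d) ℝ, 0 < A.det ∧
    ∀ j, fderiv ℝ φ y (Pi.single j 1) = ∑ i, A i j • τ (φ y) i
  null_compl : @Measure.hausdorffMeasure E _ (borel E) (@BorelSpace.mk E _ (borel E) rfl) (d : ℝ) (S \ φ '' D) = 0

/-- The coefficient of the pullback `φ^* ω` of a complex-valued `d`-form `ω`:
`φ^* ω = (pullbackCoeff ω φ) dy₁ ∧ ⋯ ∧ dy_d`. -/
noncomputable def pullbackCoeff {d : ℕ} (ω : E → E [⋀^Fin d]→ₗ[ℝ] ℂ) (φ : (Fin d → ℝ) → E)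
    (y : Fin d → ℝ) : ℂ :=
  ω (φ y) fun j => fderiv ℝ φ y (Pi.single j 1)

/-- The `d`-form `ω` is integrable over the submanifold `S` oriented by the frame field `τ`, with
`∫_S ω = I`: the integral is `∫_D φ^* ω` for a positively oriented parametrization `φ : D → S` up
to a null set (by the change of variables formula the value does not depend on `φ`). -/
def HasFormIntegral {d : ℕ} (S : Set E) (τ : E → Fin d → E) (ω : E → E [⋀^Fin d]→ₗ[ℝ] ℂ)
    (I : ℂ) : Prop :=
  ∃ (D : Set (Fin d → ℝ)) (φ : (Fin d → ℝ) → E), IsPositiveParametrization S τ D φ ∧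
    IntegrableOn (pullbackCoeff ω φ) D ∧ ∫ y in D, pullbackCoeff ω φ y = I

end Integration

/-- The complexified quaternions, realized as the complex `2 × 2` matrices. -/
abbrev HC : Type := Matrix (Fin 2) (Fin 2) ℂ

/- A norm on the finite-dimensional space `HC`; only its topology, the notion of `C¹` map and the
null sets of the Hausdorff measure are used, and these are the same for all norms. -/
attribute [local instance] Matrix.normedAddCommGroup Matrix.normedSpace

namespace HC

/-- `ẽ₀ = -i e₀, e₁, e₂, e₃`: the positively oriented basis of the space of skew-Hermitian
matrices, that is, of the tangent space of `U(2)` at `1`. -/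
noncomputable def basisM : Fin 4 → HC :=
  ![!![-Complex.I, 0; 0, -Complex.I], !![0, -Complex.I; -Complex.I, 0],
    !![0, -1; 1, 0], !![-Complex.I, 0; 0, Complex.I]]

/-- The real quaternions inside `HC`: `x⁰ + x¹ e₁ + x² e₂ + x³ e₃`. -/
noncomputable def ofQuaternion (X : ℍ[ℝ]) : HC :=
  (X.re : ℂ) • (1 : HC) + (X.imI : ℂ) • basisM 1 + (X.imJ : ℂ) • basisM 2
    + (X.imK : ℂ) • basisM 3

/-- The quadratic form `N` on `HC`. -/
noncomputable def N (Z : HC) : ℂ := Z.det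

/-- `N` on `HC` extends `N(X) = X X⁺` on the real quaternions. -/
theorem N_ofQuaternion (X : ℍ[ℝ]) : N (ofQuaternion X) = (Quaternion.normSq X : ℝ) := by
  simp only [N, ofQuaternion, basisM, Matrix.det_fin_two, Quaternion.normSq_def']
  simp
  ring_nf
  simp

/-- `U(2)_R = {R Z ; Z ∈ U(2)}`. -/
def U2 (R : ℝ) : Set HC := (fun Z : HC => R • Z) '' (Matrix.unitaryGroup (Fin 2) ℂ : Set HC)

/-- The orientation of `U(2)_R`: at `Z` it is given by the left translates
`Z ẽ₀, Z e₁, Z e₂, Z e₃` of the positively oriented basis of the tangent space of `U(2)` at `1`. -/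
noncomputable def frame (Z : HC) : Fin 4 → HC := fun i => Z * basisM i

/-- The coordinates `(z₁₁, z₁₂, z₂₁, z₂₂)`. -/
def coords : HC →ₗ[ℝ] (Fin 4 → ℂ) where
  toFun Z := ![Z 0 0, Z 0 1, Z 1 0, Z 1 1]
  map_add' Z Z' := by ext i; fin_cases i <;> rfl
  map_smul' c Z := by ext i; fin_cases i <;> rfl

/-- `dZ⁴ = dz₁₁ ∧ dz₁₂ ∧ dz₂₁ ∧ dz₂₂`, that is,
`dZ⁴(V₁, V₂, V₃, V₄) = det (coordinate j of V_i)`. -/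
noncomputable def dZ4 : HC [⋀^Fin 4]→ₗ[ℝ] ℂ where
  toMultilinearMap :=
    ((Matrix.detRowAlternating (n := Fin 4) (R := ℂ)).toMultilinearMap.restrictScalars ℝ).compLinearMap
      fun _ => coords
  map_eq_zero_of_eq' V i j hV hij := by
    refine Matrix.det_zero_of_row_eq (M := fun k => coords (V k)) hij ?_
    simp only [hV]

theorem dZ4_apply (V : Fin 4 → HC) :
    dZ4 V = Matrix.det (Matrix.of fun i => coords (V i)) := rfl

/-- The value of a polynomial in the matrix entries `z_ij` at `Z`. -/
noncomputable def evalPoly (F : MvPolynomial (Fin 2 × Fin 2) ℂ) (Z : HC) : ℂ :=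
  MvPolynomial.eval (fun p => Z p.1 p.2) F

end HC

/-!
Write `W = R w` with `w` in the open unit ball of matrices for the operator norm. The pseudo-unitary
group `U(2, 2)` acts on this ball, transitively, and on `U(2)` by linear fractional transformations,
so there is such a transformation `ψ` with `ψ(0) = w`. Since `ψ(Z') - ψ(Z) = K(Z) (Z' - Z) D(Z')⁻¹`,
where `D` is the denominator of `ψ`, the substitution `Z ↦ R ψ(Z)` multiplies `dZ⁴` by
`R⁴ (det K(Z) / det D(Z))²` and turns `N(Z - W)²` into `R⁴ (det K(Z) det Z / det D(0))²`. What is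
left is `h(Z) dZ⁴ / (det Z)²` on `U(2)`, where `h` is holomorphic in the ball and `h(0) = F(W)`. The
form `dZ⁴ / (det Z)²` is a Haar measure of `U(2)` up to a constant, so averaging over the circles
`{e^{it} Q}` and applying the mean value property to `z ↦ h(z Q)` produces a multiple of `h(0)`.
-/

open scoped ComplexOrder

section LinearFractional

variable {n R : Type*} [Fintype n] [DecidableEq n] [CommRing R]

/-- The numerator `A Z + B` of the linear fractional transformation given by a block matrix `M`
with rows `(A, B)` and `(C, D)`. -/
def linFracNum (M : Matrix (n ⊕ n) (n ⊕ n) R) (Z : Matrix n n R) : Matrix n n R :=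
  M.toBlocks₁₁ * Z + M.toBlocks₁₂

/-- The denominator `C Z + D` of the linear fractional transformation given by a block matrix `M`
with rows `(A, B)` and `(C, D)`. -/
def linFracDenom (M : Matrix (n ⊕ n) (n ⊕ n) R) (Z : Matrix n n R) : Matrix n n R :=
  M.toBlocks₂₁ * Z + M.toBlocks₂₂

/-- The linear fractional transformation `Z ↦ (A Z + B) (C Z + D)⁻¹` of square matrices given by a
block matrix `M` with rows `(A, B)` and `(C, D)`; meaningful only where `C Z + D` is invertible. -/
noncomputable def linFrac (M : Matrix (n ⊕ n) (n ⊕ n) R) (Z : Matrix n n R) : Matrix n n R :=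
  linFracNum M Z * (linFracDenom M Z)⁻¹

/-- The factor `A - ψ(Z) C` that multiplies increments from the left in
`ψ(Z') - ψ(Z) = (A - ψ(Z) C) (Z' - Z) (C Z' + D)⁻¹`, where `ψ = linFrac M`. -/
noncomputable def linFracCofactor (M : Matrix (n ⊕ n) (n ⊕ n) R) (Z : Matrix n n R) :
    Matrix n n R :=
  M.toBlocks₁₁ - linFrac M Z * M.toBlocks₂₁

variable {M M' : Matrix (n ⊕ n) (n ⊕ n) R} {Z Z' : Matrix n n R}

omit [DecidableEq n] in
theorem mul_fromRows (M : Matrix (n ⊕ n) (n ⊕ n) R) (X Y : Matrix n n R) :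
    M * fromRows X Y = fromRows (M.toBlocks₁₁ * X + M.toBlocks₁₂ * Y)
      (M.toBlocks₂₁ * X + M.toBlocks₂₂ * Y) := by
  conv_lhs => rw [← fromBlocks_toBlocks M, fromBlocks_mul_fromRows]

theorem mul_fromRows_one (M : Matrix (n ⊕ n) (n ⊕ n) R) (Z : Matrix n n R) :
    M * fromRows Z (1 : Matrix n n R) = fromRows (linFracNum M Z) (linFracDenom M Z) := by
  simp only [mul_fromRows, mul_one, linFracNum, linFracDenom]

theorem linFrac_mul_linFracDenom (h : IsUnit (linFracDenom M Z).det) :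
    linFrac M Z * linFracDenom M Z = linFracNum M Z :=
  nonsing_inv_mul_cancel_right _ _ h

theorem linFrac_one (Z : Matrix n n R) : linFrac 1 Z = Z := by
  simp [linFrac, linFracNum, linFracDenom, ← fromBlocks_one]

theorem linFrac_mul (h : IsUnit (linFracDenom M' Z).det) :
    linFrac (M * M') Z = linFrac M (linFrac M' Z) := by
  have key : fromRows (linFracNum (M * M') Z) (linFracDenom (M * M') Z) =
      fromRows (linFracNum M (linFrac M' Z)) (linFracDenom M (linFrac M' Z)) *
        linFracDenom M' Z := by
    rw [← mul_fromRows_one, ← mul_fromRows_one, Matrix.mul_assoc, Matrix.mul_assoc, fromRows_mul,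
      linFrac_mul_linFracDenom h, Matrix.one_mul, ← mul_fromRows_one]
  obtain ⟨hnum, hdenom⟩ := fromRows_inj (key.trans (fromRows_mul _ _ _))
  rw [linFrac, hnum, hdenom, Matrix.mul_inv_rev, ← Matrix.mul_assoc,
    mul_nonsing_inv_cancel_right _ _ h, ← linFrac]

theorem linFrac_sub_linFrac (h : IsUnit (linFracDenom M Z).det)
    (h' : IsUnit (linFracDenom M Z').det) :
    linFrac M Z' - linFrac M Z = linFracCofactor M Z * (Z' - Z) * (linFracDenom M Z')⁻¹ := by
  have num_sub : M.toBlocks₁₁ * (Z' - Z) = linFracNum M Z' - linFracNum M Z := by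
    simp only [linFracNum, Matrix.mul_sub, add_sub_add_right_eq_sub]
  have denom_sub : M.toBlocks₂₁ * (Z' - Z) = linFracDenom M Z' - linFracDenom M Z := by
    simp only [linFracDenom, Matrix.mul_sub, add_sub_add_right_eq_sub]
  have key : linFracCofactor M Z * (Z' - Z) =
      (linFrac M Z' - linFrac M Z) * linFracDenom M Z' := by
    rw [linFracCofactor, sub_mul, mul_assoc, num_sub, denom_sub, mul_sub, sub_mul,
      linFrac_mul_linFracDenom h, linFrac_mul_linFracDenom h']
    abel
  rw [key, mul_nonsing_inv_cancel_right _ _ h']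

end LinearFractional

section PseudoUnitary

variable {n : Type*} [Fintype n] [DecidableEq n]

/-- Membership in the pseudo-unitary group `U(n, n)` of the Hermitian form
`|x|² - |y|²` on `ℂⁿ ⊕ ℂⁿ`. -/
def IsPseudoUnitary (M : Matrix (n ⊕ n) (n ⊕ n) ℂ) : Prop :=
  Mᴴ * fromBlocks 1 0 0 (-1) * M = fromBlocks 1 0 0 (-1)

variable {M : Matrix (n ⊕ n) (n ⊕ n) ℂ} {Z w : Matrix n n ℂ}

namespace IsPseudoUnitary

theorem isUnit_det (hM : IsPseudoUnitary M) : IsUnit M.det := by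
  refine isUnit_det_of_left_inverse (B := fromBlocks 1 0 0 (-1) * (Mᴴ * fromBlocks 1 0 0 (-1))) ?_
  rw [Matrix.mul_assoc, hM, fromBlocks_multiply]
  simp only [mul_one, mul_zero, add_zero, mul_neg, neg_neg, neg_zero, zero_add, fromBlocks_one]

theorem inv (hM : IsPseudoUnitary M) : IsPseudoUnitary M⁻¹ := by
  have hMi : M * M⁻¹ = 1 := mul_nonsing_inv _ hM.isUnit_det
  have hMi' : (M⁻¹)ᴴ * Mᴴ = 1 := by rw [← conjTranspose_mul, hMi, conjTranspose_one]
  unfold IsPseudoUnitary at *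
  calc (M⁻¹)ᴴ * fromBlocks 1 0 0 (-1) * M⁻¹
      = (M⁻¹)ᴴ * (Mᴴ * fromBlocks 1 0 0 (-1) * M) * M⁻¹ := by rw [hM]
    _ = ((M⁻¹)ᴴ * Mᴴ) * fromBlocks 1 0 0 (-1) * (M * M⁻¹) := by simp only [Matrix.mul_assoc]
    _ = fromBlocks 1 0 0 (-1) := by rw [hMi, hMi', Matrix.one_mul, Matrix.mul_one]

theorem conjTranspose_mul_sub (hM : IsPseudoUnitary M) (X Y X' Y' : Matrix n n ℂ) :
    (M.toBlocks₁₁ * X + M.toBlocks₁₂ * Y)ᴴ * (M.toBlocks₁₁ * X' + M.toBlocks₁₂ * Y') -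
      (M.toBlocks₂₁ * X + M.toBlocks₂₂ * Y)ᴴ * (M.toBlocks₂₁ * X' + M.toBlocks₂₂ * Y') =
    Xᴴ * X' - Yᴴ * Y' := by
  have form (A B A' B' : Matrix n n ℂ) :
      (fromRows A B)ᴴ * (fromBlocks 1 0 0 (-1) : Matrix (n ⊕ n) (n ⊕ n) ℂ) * fromRows A' B' =
        Aᴴ * A' - Bᴴ * B' := by
    rw [conjTranspose_fromRows_eq_fromCols_conjTranspose, fromCols_mul_fromBlocks,
      fromCols_mul_fromRows]
    simp only [Matrix.mul_one, Matrix.mul_zero, add_zero, zero_add, Matrix.mul_neg, Matrix.neg_mul,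
      sub_eq_add_neg]
  rw [← form, ← form, ← mul_fromRows, ← mul_fromRows, conjTranspose_mul, Matrix.mul_assoc,
    Matrix.mul_assoc, ← Matrix.mul_assoc Mᴴ, ← Matrix.mul_assoc (Mᴴ * _),
    show Mᴴ * fromBlocks 1 0 0 (-1) * M = _ from hM, ← Matrix.mul_assoc]

theorem conjTranspose_linFracDenom_mul_self_sub (hM : IsPseudoUnitary M) (Z : Matrix n n ℂ) :
    (linFracDenom M Z)ᴴ * linFracDenom M Z - (linFracNum M Z)ᴴ * linFracNum M Z = 1 - Zᴴ * Z := by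
  have := hM.conjTranspose_mul_sub Z 1 Z 1
  simp only [mul_one, conjTranspose_one] at this
  rw [linFracDenom, linFracNum, ← neg_sub, this, neg_sub]

theorem det_linFracDenom_ne_zero (hM : IsPseudoUnitary M) (hZ : (1 - Zᴴ * Z).PosSemidef) :
    (linFracDenom M Z).det ≠ 0 := by
  refine fun h => ?_
  obtain ⟨v, hv, hdenom⟩ := exists_mulVec_eq_zero_iff.2 h
  have hnum : linFracNum M Z *ᵥ v = 0 := by
    have hnonneg := hZ.dotProduct_mulVec_nonneg v
    rw [← hM.conjTranspose_linFracDenom_mul_self_sub, sub_mulVec, ← mulVec_mulVec, hdenom,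
      mulVec_zero, zero_sub, ← mulVec_mulVec, dotProduct_neg, dotProduct_mulVec, ← star_mulVec,
      neg_nonneg] at hnonneg
    exact dotProduct_star_self_eq_zero.1 (hnonneg.antisymm (dotProduct_star_self_nonneg _))
  have hinv : (M.toBlocks₁₂)ᴴ * linFracNum M Z - (M.toBlocks₂₂)ᴴ * linFracDenom M Z = -1 := by
    simpa [linFracNum, linFracDenom] using hM.conjTranspose_mul_sub 0 1 Z 1
  refine hv (neg_eq_zero.1 ?_)
  rw [← one_mulVec v, ← neg_mulVec, ← hinv, sub_mulVec, ← mulVec_mulVec, ← mulVec_mulVec, hnum,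
    hdenom, mulVec_zero, mulVec_zero, sub_zero]

theorem conjTranspose_linFracDenom_mul_mul (hM : IsPseudoUnitary M)
    (hZ : (1 - Zᴴ * Z).PosSemidef) :
    (linFracDenom M Z)ᴴ * (1 - (linFrac M Z)ᴴ * linFrac M Z) * linFracDenom M Z = 1 - Zᴴ * Z := by
  rw [← hM.conjTranspose_linFracDenom_mul_self_sub Z,
    ← linFrac_mul_linFracDenom (hM.det_linFracDenom_ne_zero hZ).isUnit]
  simp only [conjTranspose_mul, Matrix.mul_sub, Matrix.sub_mul, Matrix.mul_one, Matrix.mul_assoc]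

theorem posDef_one_sub_linFrac (hM : IsPseudoUnitary M) (hZ : (1 - Zᴴ * Z).PosDef) :
    (1 - (linFrac M Z)ᴴ * linFrac M Z).PosDef := by
  have hdenom := (isUnit_iff_isUnit_det _).2 (hM.det_linFracDenom_ne_zero hZ.posSemidef).isUnit
  rwa [← hdenom.posDef_star_left_conjugate_iff, star_eq_conjTranspose,
    hM.conjTranspose_linFracDenom_mul_mul hZ.posSemidef]

theorem det_linFracDenom_ne_zero_of_mem_unitaryGroup (hM : IsPseudoUnitary M)
    (hZ : Z ∈ unitaryGroup n ℂ) : (linFracDenom M Z).det ≠ 0 :=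
  hM.det_linFracDenom_ne_zero <| by
    rw [← star_eq_conjTranspose, mem_unitaryGroup_iff'.1 hZ, sub_self]
    exact PosSemidef.zero

theorem linFrac_mem_unitaryGroup (hM : IsPseudoUnitary M) (hZ : Z ∈ unitaryGroup n ℂ) :
    linFrac M Z ∈ unitaryGroup n ℂ := by
  have hdenom : IsUnit (linFracDenom M Z) :=
    (isUnit_iff_isUnit_det _).2 (hM.det_linFracDenom_ne_zero_of_mem_unitaryGroup hZ).isUnit
  have hZ' : 1 - Zᴴ * Z = 0 := by
    rw [← star_eq_conjTranspose, mem_unitaryGroup_iff'.1 hZ, sub_self]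
  have hform := hM.conjTranspose_linFracDenom_mul_mul (hZ' ▸ PosSemidef.zero)
  rw [hZ', hdenom.mul_left_eq_zero, ← star_eq_conjTranspose, hdenom.star.mul_right_eq_zero,
    sub_eq_zero] at hform
  exact mem_unitaryGroup_iff'.2 hform.symm

theorem conjTranspose_mul_linFracCofactor_mul (hM : IsPseudoUnitary M)
    (hZ : Z ∈ unitaryGroup n ℂ) :
    (linFrac M Z * linFracDenom M Z)ᴴ * (linFracCofactor M Z * Z) = 1 := by
  have hdenom := (hM.det_linFracDenom_ne_zero_of_mem_unitaryGroup hZ).isUnit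
  have hψ : (linFrac M Z)ᴴ * linFrac M Z = 1 :=
    mem_unitaryGroup_iff'.1 (hM.linFrac_mem_unitaryGroup hZ)
  have hform : (linFracNum M Z)ᴴ * (M.toBlocks₁₁ * Z) - (linFracDenom M Z)ᴴ * (M.toBlocks₂₁ * Z) =
      Zᴴ * Z := by
    simpa [linFracNum, linFracDenom] using hM.conjTranspose_mul_sub Z 1 Z 0
  rw [← linFrac_mul_linFracDenom hdenom, ← star_eq_conjTranspose Z,
    mem_unitaryGroup_iff'.1 hZ] at hform
  rw [← hform, linFracCofactor, conjTranspose_mul, Matrix.sub_mul, Matrix.mul_sub]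
  simp only [Matrix.mul_assoc, ← Matrix.mul_assoc (linFrac M Z)ᴴ (linFrac M Z), hψ, Matrix.one_mul]

theorem linFrac_injOn_unitaryGroup (hM : IsPseudoUnitary M) :
    Set.InjOn (linFrac M) (unitaryGroup n ℂ) :=
  Set.LeftInvOn.injOn (f₁' := linFrac M⁻¹) fun Z hZ => by
    rw [← linFrac_mul (hM.det_linFracDenom_ne_zero_of_mem_unitaryGroup hZ).isUnit,
      nonsing_inv_mul _ hM.isUnit_det, linFrac_one]

theorem linFrac_surjOn_unitaryGroup (hM : IsPseudoUnitary M) :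
    Set.SurjOn (linFrac M) (unitaryGroup n ℂ) (unitaryGroup n ℂ) := fun Z hZ =>
  ⟨linFrac M⁻¹ Z, hM.inv.linFrac_mem_unitaryGroup hZ, by
    rw [← linFrac_mul (hM.inv.det_linFracDenom_ne_zero_of_mem_unitaryGroup hZ).isUnit,
      mul_nonsing_inv _ hM.isUnit_det, linFrac_one]⟩

end IsPseudoUnitary

open scoped MatrixOrder Matrix.Norms.L2Operator in
theorem exists_conjTranspose_mul_mul_eq_one {A : Matrix n n ℂ} (hA : A.PosDef) :
    ∃ Q : Matrix n n ℂ, Qᴴ * A * Q = 1 := by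
  obtain ⟨B, hB, rfl⟩ :=
    CStarAlgebra.isStrictlyPositive_iff_eq_star_mul_self.1 hA.isStrictlyPositive
  lift B to (Matrix n n ℂ)ˣ using hB
  refine ⟨(↑B⁻¹ : Matrix n n ℂ), ?_⟩
  rw [← star_eq_conjTranspose, ← mul_assoc, ← star_mul, mul_assoc, Units.mul_inv, star_one, mul_one]

theorem posDef_one_sub_mul_conjTranspose (hw : (1 - wᴴ * w).PosDef) : (1 - w * wᴴ).PosDef := by
  let _ : Invertible (1 : Matrix n n ℂ) := invertibleOne
  have hschur : (fromBlocks 1 w wᴴ 1).PosSemidef :=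
    (PosDef.one.fromBlocks₁₁ w 1).2 (by simpa using hw.posSemidef)
  have hw' : (1 - w * wᴴ).PosSemidef := by simpa using (PosDef.one.fromBlocks₂₂ 1 w).1 hschur
  rw [hw'.posDef_iff_det_ne_zero, det_one_sub_mul_comm]
  exact hw.det_pos.ne'

theorem exists_isPseudoUnitary_linFrac_zero_eq (hw : (1 - wᴴ * w).PosDef) :
    ∃ M : Matrix (n ⊕ n) (n ⊕ n) ℂ, IsPseudoUnitary M ∧ linFrac M 0 = w := by
  obtain ⟨Q, hQ⟩ := exists_conjTranspose_mul_mul_eq_one hw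
  obtain ⟨P, hP⟩ := exists_conjTranspose_mul_mul_eq_one (posDef_one_sub_mul_conjTranspose hw)
  refine ⟨fromBlocks P (w * Q) (wᴴ * P) Q, ?_, ?_⟩
  · rw [IsPseudoUnitary, fromBlocks_conjTranspose, fromBlocks_multiply, fromBlocks_multiply,
      fromBlocks_inj]
    refine ⟨?_, ?_, ?_, ?_⟩
    · simpa [Matrix.mul_assoc, Matrix.mul_sub, Matrix.sub_mul, ← sub_eq_add_neg] using hP
    · simp [Matrix.mul_assoc]
    · simp [Matrix.mul_assoc]
    · simpa [Matrix.mul_assoc, Matrix.mul_sub, Matrix.sub_mul, ← sub_eq_add_neg] using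
        congrArg Neg.neg hQ
  · simp only [linFrac, linFracNum, linFracDenom, Matrix.mul_zero, zero_add, toBlocks_fromBlocks₁₂,
      toBlocks_fromBlocks₂₂]
    exact mul_nonsing_inv_cancel_right _ _ (isUnit_det_of_left_inverse hQ)

end PseudoUnitary

section Calculus

variable {n 𝕜 : Type*} [Fintype n] [DecidableEq n] [NontriviallyNormedField 𝕜] {k : WithTop ℕ∞}

theorem contDiff_matrix_det : ContDiff 𝕜 k fun A : Matrix n n 𝕜 => A.det := by
  simp only [det_apply]
  exact ContDiff.sum fun σ _ =>
    (contDiff_prod fun i _ => contDiff_apply_apply 𝕜 𝕜 (σ i) i).const_smul _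

theorem contDiff_adjugate : ContDiff 𝕜 k fun A : Matrix n n 𝕜 => A.adjugate := by
  refine contDiff_pi.2 fun i => contDiff_pi.2 fun j => ?_
  simp only [adjugate_apply]
  refine contDiff_matrix_det.comp (contDiff_pi.2 fun i' => contDiff_pi.2 fun j' => ?_)
  simp only [updateRow_apply]
  split_ifs
  · exact contDiff_const
  · exact contDiff_apply_apply 𝕜 𝕜 i' j'

theorem contDiffAt_matrix_inv {A : Matrix n n 𝕜} (hA : A.det ≠ 0) :
    ContDiffAt 𝕜 k (fun A : Matrix n n 𝕜 => A⁻¹) A := by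
  simp only [inv_def, Ring.inverse_eq_inv']
  exact (contDiff_matrix_det.contDiffAt.inv hA).smul contDiff_adjugate.contDiffAt

section Product

variable {E : Type*} [NormedAddCommGroup E] [NormedSpace 𝕜 E] {x : E}

omit [DecidableEq n] in
theorem contDiffAt_matrix_mul {f g : E → Matrix n n 𝕜} (hf : ContDiffAt 𝕜 k f x)
    (hg : ContDiffAt 𝕜 k g x) : ContDiffAt 𝕜 k (fun y => f y * g y) x := by
  refine contDiffAt_pi.2 fun i => contDiffAt_pi.2 fun j => ?_
  simp only [mul_apply]
  exact ContDiffAt.sum fun l _ => ((contDiffAt_pi.1 (contDiffAt_pi.1 hf i) l)).mul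
    (contDiffAt_pi.1 (contDiffAt_pi.1 hg l) j)

omit [DecidableEq n] in
theorem fderiv_matrix_mul {A : Type*} [NormedRing A] [NormedAlgebra 𝕜 A] [CompleteSpace 𝕜]
    [FiniteDimensional 𝕜 A] {f g : E → Matrix n n A} (hf : DifferentiableAt 𝕜 f x)
    (hg : DifferentiableAt 𝕜 g x) (v : E) :
    fderiv 𝕜 (fun y => f y * g y) x v = f x * fderiv 𝕜 g x v + fderiv 𝕜 f x v * g x := by
  classical
  exact congrArg (· v)
    ((LinearMap.mul 𝕜 (Matrix n n A)).toContinuousBilinearMap.fderiv_of_bilinear hf hg)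

end Product

variable {M : Matrix (n ⊕ n) (n ⊕ n) 𝕜} {Z : Matrix n n 𝕜}

omit [DecidableEq n] in
theorem contDiff_linFracNum : ContDiff 𝕜 k (linFracNum M) :=
  contDiff_iff_contDiffAt.2 fun _ =>
    (contDiffAt_matrix_mul contDiffAt_const contDiffAt_id).add contDiffAt_const

omit [DecidableEq n] in
theorem contDiff_linFracDenom : ContDiff 𝕜 k (linFracDenom M) :=
  contDiff_iff_contDiffAt.2 fun _ =>
    (contDiffAt_matrix_mul contDiffAt_const contDiffAt_id).add contDiffAt_const

theorem contDiffAt_linFrac (h : (linFracDenom M Z).det ≠ 0) : ContDiffAt 𝕜 k (linFrac M) Z :=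
  contDiffAt_matrix_mul contDiff_linFracNum.contDiffAt
    ((contDiffAt_matrix_inv h).comp Z contDiff_linFracDenom.contDiffAt)

theorem fderiv_linFrac [CompleteSpace 𝕜] (h : (linFracDenom M Z).det ≠ 0) (V : Matrix n n 𝕜) :
    fderiv 𝕜 (linFrac M) Z V = linFracCofactor M Z * V * (linFracDenom M Z)⁻¹ := by
  have fderiv_affine (A B : Matrix n n 𝕜) : fderiv 𝕜 (fun Z => A * Z + B) Z V = A * V :=
    congrArg (· V) ((LinearMap.mulLeft 𝕜 A).toContinuousLinearMap.hasFDerivAt.add_const B).fderiv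
  have hprod : linFrac M Z * (M.toBlocks₂₁ * V) + fderiv 𝕜 (linFrac M) Z V * linFracDenom M Z =
      M.toBlocks₁₁ * V := by
    rw [← fderiv_affine _ M.toBlocks₂₂, ← fderiv_affine _ M.toBlocks₁₂]
    refine (fderiv_matrix_mul ((contDiffAt_linFrac (k := 1) h).differentiableAt one_ne_zero)
      (contDiff_linFracDenom.contDiffAt.differentiableAt (n := 1) one_ne_zero) V).symm.trans ?_
    refine congrArg (fun L : Matrix n n 𝕜 →L[𝕜] Matrix n n 𝕜 => L V)
      (Filter.EventuallyEq.fderiv_eq ?_)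
    have hdet : Continuous fun Y => (linFracDenom M Y).det :=
      ((contDiff_matrix_det (k := 0)).comp contDiff_linFracDenom).continuous
    filter_upwards [hdet.continuousAt.eventually_ne h] with Y hY
    exact linFrac_mul_linFracDenom hY.isUnit
  rw [linFracCofactor, sub_mul, mul_assoc, ← eq_sub_of_add_eq' hprod,
    mul_nonsing_inv_cancel_right _ _ h.isUnit]

theorem fderiv_linFrac_comp {E : Type*} [NormedAddCommGroup E] [NormedSpace ℝ E]
    {M : Matrix (n ⊕ n) (n ⊕ n) ℂ} {f : E → Matrix n n ℂ} {x : E} (hf : DifferentiableAt ℝ f x)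
    (h : (linFracDenom M (f x)).det ≠ 0) (v : E) :
    fderiv ℝ (fun y => linFrac M (f y)) x v =
      linFracCofactor M (f x) * fderiv ℝ f x v * (linFracDenom M (f x))⁻¹ := by
  have hψ : HasFDerivAt (linFrac M) (fderiv ℂ (linFrac M) (f x)) (f x) :=
    ((contDiffAt_linFrac (k := 1) h).differentiableAt one_ne_zero).hasFDerivAt
  rw [← fderiv_linFrac h]
  exact congrArg (· v) ((hψ.restrictScalars ℝ).comp x hf.hasFDerivAt).fderiv

end Calculus

section MatrixBall

variable {n : Type*} [Fintype n] [DecidableEq n] {R : ℝ} {Z : Matrix n n ℂ}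

/-- The open ball of radius `|R|` for the operator norm, written as the set of matrices `Z` with
`Zᴴ Z < R²` because the ambient norm on matrices is a different one. -/
def matrixBall (n : Type*) [Fintype n] [DecidableEq n] (R : ℝ) : Set (Matrix n n ℂ) :=
  {Z | (R ^ 2 • (1 : Matrix n n ℂ) - Zᴴ * Z).PosDef}

theorem smul_mem_matrixBall_iff (hR : R ≠ 0) : R • Z ∈ matrixBall n R ↔ (1 - Zᴴ * Z).PosDef := by
  have hscale : R ^ 2 • (1 : Matrix n n ℂ) - (R • Z)ᴴ * (R • Z) = R ^ 2 • (1 - Zᴴ * Z) := by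
    simp only [conjTranspose_smul, star_trivial, smul_mul_assoc, mul_smul_comm, smul_smul,
      smul_sub, sq]
  rw [matrixBall, Set.mem_ofPred_eq, hscale]
  refine ⟨fun h => ?_, fun h => h.smul (by positivity)⟩
  simpa [smul_smul, hR] using h.smul (show 0 < (R ^ 2)⁻¹ by positivity)

theorem ne_zero_of_mem_matrixBall [Nonempty n] (hZ : Z ∈ matrixBall n R) : R ≠ 0 := by
  rintro rfl
  let i : n := Classical.arbitrary n
  have hneg : 0 < -(Zᴴ * Z) i i := by
    have h : 0 < ((0 : ℝ) ^ 2 • (1 : Matrix n n ℂ) - Zᴴ * Z) i i := hZ.diag_pos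
    rwa [zero_pow two_ne_zero, zero_smul, zero_sub] at h
  exact (neg_pos.1 hneg).not_ge (posSemidef_conjTranspose_mul_self Z).diag_nonneg

theorem smul_mem_unitaryGroup {Q : Matrix n n ℂ} (hQ : Q ∈ unitaryGroup n ℂ) {z : ℂ}
    (hz : ‖z‖ = 1) : z • Q ∈ unitaryGroup n ℂ := by
  rw [mem_unitaryGroup_iff', star_smul, smul_mul_smul_comm, mem_unitaryGroup_iff'.1 hQ,
    Complex.star_def, Complex.conj_mul', hz, Complex.ofReal_one, one_pow, one_smul]

theorem one_sub_conjTranspose_smul_mul_smul {Q : Matrix n n ℂ} (hQ : Q ∈ unitaryGroup n ℂ)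
    (z : ℂ) : 1 - (z • Q)ᴴ * (z • Q) = (1 - ‖z‖ ^ 2) • (1 : Matrix n n ℂ) := by
  have hQ' : Qᴴ * Q = 1 := mem_unitaryGroup_iff'.1 hQ
  rw [conjTranspose_smul, smul_mul_smul_comm, hQ', Complex.star_def, Complex.conj_mul', sub_smul,
    one_smul]
  norm_cast

theorem posSemidef_one_sub_smul {Q : Matrix n n ℂ} (hQ : Q ∈ unitaryGroup n ℂ) {z : ℂ}
    (hz : ‖z‖ ≤ 1) : (1 - (z • Q)ᴴ * (z • Q)).PosSemidef := by
  rw [one_sub_conjTranspose_smul_mul_smul hQ]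
  exact PosSemidef.one.smul (by nlinarith [norm_nonneg z])

theorem posDef_one_sub_smul {Q : Matrix n n ℂ} (hQ : Q ∈ unitaryGroup n ℂ) {z : ℂ}
    (hz : ‖z‖ < 1) : (1 - (z • Q)ᴴ * (z • Q)).PosDef := by
  rw [one_sub_conjTranspose_smul_mul_smul hQ]
  exact PosDef.one.smul (by nlinarith [norm_nonneg z])

end MatrixBall

section LogarithmicDerivative

variable {n E : Type*} [NormedAddCommGroup E] [NormedSpace ℝ E]

theorem fderiv_conjTranspose [Finite n] {f : E → Matrix n n ℂ} {x : E}
    (hf : DifferentiableAt ℝ f x) (v : E) :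
    fderiv ℝ (fun y => (f y)ᴴ) x v = (fderiv ℝ f x v)ᴴ := by
  have := Fintype.ofFinite n
  exact congrArg (· v)
    ((conjTransposeLinearEquiv n n ℝ ℂ).toContinuousLinearEquiv.hasFDerivAt.comp x
      hf.hasFDerivAt).fderiv

theorem conjTranspose_inv_mul_fderiv [Fintype n] [DecidableEq n] {f : E → Matrix n n ℂ} {c : ℝ}
    (hc : c ≠ 0) (h : ∀ x, (f x)ᴴ * f x = c • (1 : Matrix n n ℂ)) {x : E}
    (hf : DifferentiableAt ℝ f x) (v : E) :
    ((f x)⁻¹ * fderiv ℝ f x v)ᴴ = -((f x)⁻¹ * fderiv ℝ f x v) := by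
  have hinv : (f x)⁻¹ = c⁻¹ • (f x)ᴴ :=
    inv_eq_left_inv (by rw [smul_mul_assoc, h, smul_smul, inv_mul_cancel₀ hc, one_smul])
  have hstar : DifferentiableAt ℝ (fun y => (f y)ᴴ) x :=
    (conjTransposeLinearEquiv n n ℝ ℂ).toContinuousLinearEquiv.differentiableAt.comp x hf
  have hconst : (f x)ᴴ * fderiv ℝ f x v + (fderiv ℝ f x v)ᴴ * f x = 0 := by
    rw [← fderiv_conjTranspose hf, ← fderiv_matrix_mul hstar hf, funext h, fderiv_fun_const]
    rfl
  rw [hinv, smul_mul_assoc, conjTranspose_smul, conjTranspose_mul, conjTranspose_conjTranspose,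
    star_trivial, ← smul_neg, neg_eq_of_add_eq_zero_right hconst]

end LogarithmicDerivative

namespace HC

section VolumeForm

theorem dZ4_mul_left (M : HC) (V : Fin 4 → HC) :
    dZ4 (fun j => M * V j) = M.det ^ 2 * dZ4 V := by
  have hcoords : (of fun i => coords (M * V i)) = (of fun i => coords (V i)) *
      !![M 0 0, 0, M 1 0, 0; 0, M 0 0, 0, M 1 0; M 0 1, 0, M 1 1, 0; 0, M 0 1, 0, M 1 1] := by
    ext i j
    fin_cases j <;> simp [coords, mul_apply, Fin.sum_univ_succ] <;> ring
  rw [dZ4_apply, dZ4_apply, hcoords, det_mul, mul_comm]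
  congr 1
  simp [det_succ_row_zero, Fin.sum_univ_succ, Fin.succAbove]
  ring

theorem dZ4_mul_right (M : HC) (V : Fin 4 → HC) :
    dZ4 (fun j => V j * M) = M.det ^ 2 * dZ4 V := by
  have hcoords : (of fun i => coords (V i * M)) = (of fun i => coords (V i)) *
      !![M 0 0, M 0 1, 0, 0; M 1 0, M 1 1, 0, 0; 0, 0, M 0 0, M 0 1; 0, 0, M 1 0, M 1 1] := by
    ext i j
    fin_cases j <;> simp [coords, mul_apply, Fin.sum_univ_succ]
  rw [dZ4_apply, dZ4_apply, hcoords, det_mul, mul_comm]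
  congr 1
  simp [det_succ_row_zero, Fin.sum_univ_succ, Fin.succAbove]
  ring

theorem dZ4_sum_smul (A : Matrix (Fin 4) (Fin 4) ℝ) (e : Fin 4 → HC) :
    dZ4 (fun j => ∑ i, A i j • e i) = (A.det : ℂ) * dZ4 e := by
  have hcoords : (of fun j => coords (∑ i, A i j • e i)) =
      (A.map Complex.ofRealHom)ᵀ * (of fun i => coords (e i)) := by
    ext j k
    simp [mul_apply, map_sum]
  rw [dZ4_apply, dZ4_apply, hcoords, det_mul, det_transpose, ← RingHom.mapMatrix_apply,
    ← RingHom.map_det, Complex.ofRealHom_eq_coe]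

theorem dZ4_basisM : dZ4 basisM = -4 * Complex.I := by
  rw [dZ4_apply]
  simp [det_succ_row_zero, Fin.sum_univ_succ, Fin.succAbove, coords, basisM]
  ring

theorem dZ4_frame (Z : HC) : dZ4 (frame Z) = Z.det ^ 2 * (-4 * Complex.I) := by
  rw [← dZ4_basisM, ← dZ4_mul_left]
  rfl

theorem exists_sum_smul_basisM_eq {X : HC} (hX : Xᴴ = -X) :
    ∃ a : Fin 4 → ℝ, ∑ i, a i • basisM i = X := by
  have h00 := congrFun (congrFun hX 0) 0
  have h01 := congrFun (congrFun hX 1) 0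
  have h11 := congrFun (congrFun hX 1) 1
  simp only [conjTranspose_apply, Matrix.neg_apply, Complex.ext_iff, Complex.star_def,
    Complex.conj_re, Complex.conj_im, Complex.neg_re, Complex.neg_im] at h00 h01 h11
  refine ⟨![-((X 0 0).im + (X 1 1).im) / 2, -(X 0 1).im, -(X 0 1).re,
    ((X 1 1).im - (X 0 0).im) / 2], ?_⟩
  ext i j
  fin_cases i <;> fin_cases j <;> apply Complex.ext <;>
    simp [Fin.sum_univ_succ, basisM] <;> linarith

theorem exists_eq_sum_smul_frame {Z : HC} (hZ : IsUnit Z.det) {V : Fin 4 → HC}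
    (hV : ∀ j, (Z⁻¹ * V j)ᴴ = -(Z⁻¹ * V j)) :
    ∃ A : Matrix (Fin 4) (Fin 4) ℝ, ∀ j, V j = ∑ i, A i j • frame Z i := by
  choose a ha using fun j => exists_sum_smul_basisM_eq (hV j)
  refine ⟨of fun i j => a j i, fun j => ?_⟩
  rw [← mul_nonsing_inv_cancel_left Z (V j) hZ, ← ha, Matrix.mul_sum]
  simp only [mul_smul_comm, of_apply, frame]

end VolumeForm

end HC

namespace HC

section PolarCoordinates

/-- The diagonal unitary matrix with entries `1` and `e^{it}`. -/
noncomputable def phase (t : ℝ) : HC := !![1, 0; 0, Complex.exp (t * Complex.I)]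

/-- The rotation by the angle `-θ`. -/
noncomputable def rotation (θ : ℝ) : HC :=
  !![(Real.cos θ : ℂ), (Real.sin θ : ℂ); -(Real.sin θ : ℂ), (Real.cos θ : ℂ)]

/-- Polar coordinates on `U(2)`. The angle `y 0` multiplies everything, so that integrating over it
averages over a circle of scalars. -/
noncomputable def polar (y : Fin 4 → ℝ) : HC :=
  Complex.exp (y 0 * Complex.I) • (phase (y 2) * rotation (y 3) * phase (y 1))

/-- The increment of `polar` along `v`, up to the outer factors of `polar`. -/
noncomputable def polarIncrement (θ : ℝ) (v : Fin 4 → ℝ) : HC :=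
  !![v 0 * Complex.I * Real.cos θ - v 3 * Real.sin θ,
    (v 0 + v 1) * Complex.I * Real.sin θ + v 3 * Real.cos θ;
    -((v 0 + v 2) * Complex.I * Real.sin θ + v 3 * Real.cos θ),
    (v 0 + v 1 + v 2) * Complex.I * Real.cos θ - v 3 * Real.sin θ]

theorem phase_mem_unitaryGroup (t : ℝ) : phase t ∈ unitaryGroup (Fin 2) ℂ := by
  have hexp : Complex.exp (t * Complex.I) * starRingEnd ℂ (Complex.exp (t * Complex.I)) = 1 := by
    rw [Complex.mul_conj', Complex.norm_exp_ofReal_mul_I, Complex.ofReal_one, one_pow]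
  rw [mem_unitaryGroup_iff]
  ext i j
  fin_cases i <;> fin_cases j <;> simp [phase, mul_apply, star_apply, hexp]

theorem rotation_mem_unitaryGroup (θ : ℝ) : rotation θ ∈ unitaryGroup (Fin 2) ℂ := by
  have hsq : (Real.cos θ : ℂ) ^ 2 + (Real.sin θ : ℂ) ^ 2 = 1 := by
    exact_mod_cast Real.cos_sq_add_sin_sq θ
  rw [mem_unitaryGroup_iff]
  ext i j
  fin_cases i <;> fin_cases j <;>
    simp [rotation, mul_apply, star_apply, -Complex.ofReal_cos, -Complex.ofReal_sin]
  · linear_combination hsq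
  · ring
  · ring
  · linear_combination hsq

theorem polar_mem_unitaryGroup (y : Fin 4 → ℝ) : polar y ∈ unitaryGroup (Fin 2) ℂ :=
  smul_mem_unitaryGroup (mul_mem (mul_mem (phase_mem_unitaryGroup _) (rotation_mem_unitaryGroup _))
    (phase_mem_unitaryGroup _)) (Complex.norm_exp_ofReal_mul_I _)

theorem polar_eq (y : Fin 4 → ℝ) :
    polar y = Complex.exp (y 0 * Complex.I) •
      !![(Real.cos (y 3) : ℂ), Real.sin (y 3) * Complex.exp (y 1 * Complex.I);
        -(Real.sin (y 3) * Complex.exp (y 2 * Complex.I)),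
        Real.cos (y 3) * (Complex.exp (y 1 * Complex.I) * Complex.exp (y 2 * Complex.I))] := by
  rw [polar]
  congr 1
  ext i j
  fin_cases i <;> fin_cases j <;> simp [phase, rotation, mul_apply] <;> ring

theorem contDiff_polar : ContDiff ℝ 1 polar := by
  have hof : ∀ k : Fin 4, ContDiff ℝ 1 fun y : Fin 4 → ℝ => (y k : ℂ) := fun k =>
    Complex.ofRealCLM.contDiff.comp (contDiff_apply ℝ ℝ k)
  have hexp : ∀ k : Fin 4, ContDiff ℝ 1 fun y : Fin 4 → ℝ => Complex.exp (y k * Complex.I) :=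
    fun k => ((hof k).mul contDiff_const).cexp
  have hcos : ContDiff ℝ 1 fun y : Fin 4 → ℝ => (Real.cos (y 3) : ℂ) :=
    Complex.ofRealCLM.contDiff.comp (Real.contDiff_cos.comp (contDiff_apply ℝ ℝ 3))
  have hsin : ContDiff ℝ 1 fun y : Fin 4 → ℝ => (Real.sin (y 3) : ℂ) :=
    Complex.ofRealCLM.contDiff.comp (Real.contDiff_sin.comp (contDiff_apply ℝ ℝ 3))
  rw [funext polar_eq]
  refine contDiff_pi.2 fun i => contDiff_pi.2 fun j => ?_
  fin_cases i <;> fin_cases j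
  · exact (hexp 0).mul hcos
  · exact (hexp 0).mul (hsin.mul (hexp 1))
  · exact (hexp 0).mul (hsin.mul (hexp 2)).neg
  · exact (hexp 0).mul (hcos.mul ((hexp 1).mul (hexp 2)))

theorem fderiv_polar (y v : Fin 4 → ℝ) :
    fderiv ℝ polar y v = (Complex.exp (y 0 * Complex.I) • phase (y 2)) *
      polarIncrement (y 3) v * phase (y 1) := by
  have hline : ∀ k, HasDerivAt (fun s : ℝ => (y + s • v) k) (v k) 0 := fun k => by
    simpa using ((hasDerivAt_id (0 : ℝ)).mul_const (v k)).const_add (y k)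
  have hexp : ∀ k, HasDerivAt (fun s : ℝ => Complex.exp (((y + s • v) k : ℝ) * Complex.I))
      (Complex.exp (y k * Complex.I) * (v k * Complex.I)) 0 := fun k => by
    simpa using ((hline k).ofReal_comp.mul_const Complex.I).cexp
  have hcos : HasDerivAt (fun s : ℝ => (Real.cos ((y + s • v) 3) : ℂ))
      ((-Real.sin (y 3) * v 3 : ℝ) : ℂ) 0 := by
    simpa using (hline 3).cos.ofReal_comp
  have hsin : HasDerivAt (fun s : ℝ => (Real.sin ((y + s • v) 3) : ℂ))
      ((Real.cos (y 3) * v 3 : ℝ) : ℂ) 0 := by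
    simpa using (hline 3).sin.ofReal_comp
  refine (contDiff_polar.differentiable one_ne_zero y).lineDeriv_eq_fderiv.symm.trans
    (HasLineDerivAt.lineDeriv ?_)
  rw [HasLineDerivAt, funext fun s => polar_eq (y + s • v)]
  refine hasDerivAt_pi.2 fun i => hasDerivAt_pi.2 fun j => ?_
  fin_cases i <;> fin_cases j
  · refine ((hexp 0).mul hcos).congr_deriv ?_
    simp [phase, polarIncrement, mul_apply]; ring
  · refine ((hexp 0).mul (hsin.mul (hexp 1))).congr_deriv ?_
    simp [phase, polarIncrement, mul_apply]; ring
  · refine ((hexp 0).mul (hsin.mul (hexp 2)).neg).congr_deriv ?_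
    simp [phase, polarIncrement, mul_apply]; ring
  · refine ((hexp 0).mul (hcos.mul ((hexp 1).mul (hexp 2)))).congr_deriv ?_
    simp [phase, polarIncrement, mul_apply]; ring

theorem dZ4_polarIncrement (θ : ℝ) :
    dZ4 (fun j => polarIncrement θ (Pi.single j 1)) =
      -2 * Complex.I * (Real.sin θ * Real.cos θ : ℝ) := by
  have hsq : (Real.cos θ : ℂ) ^ 2 + (Real.sin θ : ℂ) ^ 2 = 1 := by
    exact_mod_cast Real.cos_sq_add_sin_sq θ
  rw [dZ4_apply]
  push_cast at hsq ⊢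
  simp [det_succ_row_zero, Fin.sum_univ_succ, Fin.succAbove, coords, polarIncrement,
    Pi.single_apply]
  linear_combination (2 * Complex.I ^ 3 * Complex.cos θ * Complex.sin θ) * hsq +
    (2 * Complex.I * Complex.cos θ * Complex.sin θ) * Complex.I_sq

theorem dZ4_fderiv_polar (y : Fin 4 → ℝ) :
    dZ4 (fun j => fderiv ℝ polar y (Pi.single j 1)) =
      -2 * Complex.I * (Real.sin (y 3) * Real.cos (y 3) : ℝ) * (polar y).det ^ 2 := by
  have hrot : (rotation (y 3)).det = 1 := by
    rw [rotation, det_fin_two_of]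
    linear_combination (by exact_mod_cast Real.cos_sq_add_sin_sq (y 3) :
      (Real.cos (y 3) : ℂ) ^ 2 + (Real.sin (y 3) : ℂ) ^ 2 = 1)
  have hdet : (polar y).det =
      (Complex.exp (y 0 * Complex.I) • phase (y 2)).det * (phase (y 1)).det := by
    rw [polar, ← smul_mul_assoc, ← smul_mul_assoc, det_mul, det_mul, hrot, mul_one]
  simp only [fderiv_polar]
  rw [dZ4_mul_right _ fun j => _ * polarIncrement (y 3) (Pi.single j 1), dZ4_mul_left,
    dZ4_polarIncrement, hdet]
  ring

/-- The upper ends of the coordinate intervals of `polar`. -/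
noncomputable def polarBound : Fin 4 → ℝ :=
  ![2 * Real.pi, 2 * Real.pi, 2 * Real.pi, Real.pi / 2]

/-- The open box on which `polar` is a coordinate system. -/
def polarBox : Set (Fin 4 → ℝ) := Set.univ.pi fun i => Set.Ioo 0 (polarBound i)

theorem mem_polarBox {y : Fin 4 → ℝ} : y ∈ polarBox ↔ ∀ i, y i ∈ Set.Ioo 0 (polarBound i) :=
  Set.mem_univ_pi

theorem sin_pos_and_cos_pos_of_mem_polarBox {y : Fin 4 → ℝ} (hy : y ∈ polarBox) :
    0 < Real.sin (y 3) ∧ 0 < Real.cos (y 3) := by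
  have hy3 : y 3 ∈ Set.Ioo 0 (Real.pi / 2) := mem_polarBox.1 hy 3
  exact ⟨Real.sin_pos_of_pos_of_lt_pi hy3.1 (hy3.2.trans (half_lt_self Real.pi_pos)),
    Real.cos_pos_of_mem_Ioo ⟨by linarith [hy3.1, Real.pi_pos], hy3.2⟩⟩

theorem injOn_exp_mul_I :
    Set.InjOn (fun t : ℝ => Complex.exp (t * Complex.I)) (Set.Ioo 0 (2 * Real.pi)) :=
  (Subtype.val_injective.injOn.comp (Circle.exp_injOn_Ioc (sub_zero _).le)
    (Set.mapsTo_univ _ _)).mono Set.Ioo_subset_Ioc_self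

theorem polar_injOn : Set.InjOn polar polarBox := by
  intro y hy z hz h
  obtain ⟨hsin, hcos⟩ := sin_pos_and_cos_pos_of_mem_polarBox hy
  have hcos' := (sin_pos_and_cos_pos_of_mem_polarBox hz).2
  have hsin0 : (Real.sin (y 3) : ℂ) ≠ 0 := by exact_mod_cast hsin.ne'
  have hcos0 : (Real.cos (y 3) : ℂ) ≠ 0 := by exact_mod_cast hcos.ne'
  rw [mem_polarBox] at hy hz
  rw [polar_eq, polar_eq] at h
  have h00 := congrFun₂ h 0 0
  have h01 := congrFun₂ h 0 1
  have h10 := congrFun₂ h 1 0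
  simp only [Matrix.smul_apply, smul_eq_mul, of_apply, cons_val_zero, cons_val_one, cons_val',
    cons_val_fin_one] at h00 h01 h10
  have h3 : y 3 = z 3 := by
    have hnorm := congrArg norm h00
    rw [norm_mul, norm_mul, Complex.norm_exp_ofReal_mul_I, Complex.norm_exp_ofReal_mul_I,
      Complex.norm_real, Complex.norm_real, Real.norm_of_nonneg hcos.le,
      Real.norm_of_nonneg hcos'.le, one_mul, one_mul] at hnorm
    exact Real.injOn_cos ⟨(hy 3).1.le, (hy 3).2.le.trans (half_le_self Real.pi_pos.le)⟩
      ⟨(hz 3).1.le, (hz 3).2.le.trans (half_le_self Real.pi_pos.le)⟩ hnorm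
  rw [← h3] at h00 h01 h10
  have hexp0 := mul_right_cancel₀ hcos0 h00
  rw [← hexp0] at h01 h10
  have hexp1 := mul_left_cancel₀ hsin0 (mul_left_cancel₀ (Complex.exp_ne_zero _) h01)
  have hexp2 :=
    mul_left_cancel₀ hsin0 (neg_injective (mul_left_cancel₀ (Complex.exp_ne_zero _) h10))
  ext i
  fin_cases i
  exacts [injOn_exp_mul_I (hy 0) (hz 0) hexp0, injOn_exp_mul_I (hy 1) (hz 1) hexp1,
    injOn_exp_mul_I (hy 2) (hz 2) hexp2, h3]

theorem exists_norm_mul_exp_eq (z : ℂ) :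
    ∃ t ∈ Set.Icc 0 (2 * Real.pi), ‖z‖ * Complex.exp (t * Complex.I) = z := by
  have ht := toIcoMod_mem_Ico Real.two_pi_pos 0 z.arg
  refine ⟨toIcoMod Real.two_pi_pos 0 z.arg, ⟨ht.1, ?_⟩, ?_⟩
  · simpa using ht.2.le
  · conv_rhs => rw [← Complex.norm_mul_exp_arg_mul_I z]
    rw [← Circle.coe_exp, ← Circle.coe_exp, ← self_sub_toIcoDiv_zsmul,
      Circle.periodic_exp.sub_zsmul_eq]

theorem exists_phase_mul_eq {Y Z : HC} (hY : Y ∈ unitaryGroup (Fin 2) ℂ)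
    (hZ : Z ∈ unitaryGroup (Fin 2) ℂ) (hrow : Y 0 = Z 0) :
    ∃ t ∈ Set.Icc 0 (2 * Real.pi), phase t * Y = Z := by
  set D := Z * star Y with hD
  have hDY : D * Y = Z := by
    rw [hD, mul_assoc, mem_unitaryGroup_iff'.1 hY, mul_one]
  have hD0 : D 0 = (1 : HC) 0 := by
    rw [← mem_unitaryGroup_iff.1 hY, hD]
    ext j
    rw [mul_apply, mul_apply, hrow]
  have hDD : D * star D = 1 := mem_unitaryGroup_iff.1 (mul_mem hZ (Unitary.star_mem hY))
  have hD10 : D 1 0 = 0 := by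
    simpa [mul_apply, Fin.sum_univ_two, star_apply, hD0] using congrFun₂ hDD 1 0
  have hD11 : ‖D 1 1‖ = 1 := by
    have hsq := congrFun₂ hDD 1 1
    rw [mul_apply, Fin.sum_univ_two, star_apply, star_apply, hD10, zero_mul, zero_add,
      Complex.star_def, Complex.mul_conj', one_apply_eq] at hsq
    exact (pow_eq_one_iff_of_nonneg (norm_nonneg _) two_ne_zero).1 (by exact_mod_cast hsq)
  obtain ⟨t, ht, hDt⟩ := exists_norm_mul_exp_eq (D 1 1)
  refine ⟨t, ht, ?_⟩
  rw [← hDY]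
  rw [hD11, Complex.ofReal_one, one_mul] at hDt
  rw [phase, hDt, eta_fin_two D, hD10, hD0]
  rfl

theorem polar_surjOn :
    Set.SurjOn polar (Set.Icc 0 polarBound) (unitaryGroup (Fin 2) ℂ) := by
  intro Z hZ
  have hrow : ‖Z 0 0‖ ^ 2 + ‖Z 0 1‖ ^ 2 = 1 := by
    have := congrFun₂ (mem_unitaryGroup_iff.1 hZ) 0 0
    simp only [mul_apply, Fin.sum_univ_two, star_apply, Complex.star_def, Complex.mul_conj',
      one_apply_eq] at this
    exact_mod_cast this
  have hcos : Real.cos (Real.arccos ‖Z 0 0‖) = ‖Z 0 0‖ :=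
    Real.cos_arccos (by linarith [norm_nonneg (Z 0 0)]) (by nlinarith [norm_nonneg (Z 0 0)])
  have hsin : Real.sin (Real.arccos ‖Z 0 0‖) = ‖Z 0 1‖ := by
    rw [Real.sin_arccos, ← hrow, add_sub_cancel_left, Real.sqrt_sq (norm_nonneg _)]
  obtain ⟨t, ht, h00⟩ := exists_norm_mul_exp_eq (Z 0 0)
  obtain ⟨b, hb, h01⟩ := exists_norm_mul_exp_eq (Z 0 1 / Complex.exp (t * Complex.I))
  rw [norm_div, Complex.norm_exp_ofReal_mul_I, div_one, eq_div_iff (Complex.exp_ne_zero _)] at h01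
  obtain ⟨g, hg, hZg⟩ := exists_phase_mul_eq
    (polar_mem_unitaryGroup ![t, b, 0, Real.arccos ‖Z 0 0‖]) hZ <| by
      rw [polar_eq]
      ext j
      fin_cases j
      · simpa [hcos, -Complex.ofReal_cos, mul_comm] using h00
      · simpa [hsin, -Complex.ofReal_sin, mul_comm] using h01
  have hθ := Real.arccos_le_pi_div_two.2 (norm_nonneg (Z 0 0))
  refine ⟨![t, b, g, Real.arccos ‖Z 0 0‖], ⟨?_, ?_⟩, ?_⟩
  · simp [Pi.le_def, Fin.forall_fin_succ, ht.1, hb.1, hg.1, Real.arccos_nonneg]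
  · simp [Pi.le_def, Fin.forall_fin_succ, polarBound, ht.2, hb.2, hg.2, hθ]
  · have hphase : phase 0 = 1 := by simp [phase, one_fin_two]
    simpa [polar, hphase, mul_assoc] using hZg

end PolarCoordinates

end HC

section BoxBoundary

variable {d : ℕ} {E : Type*} [NormedAddCommGroup E] [NormedSpace ℝ E]

theorem contDiff_insertNth {k : WithTop ℕ∞} (i : Fin (d + 1)) (c : ℝ) :
    ContDiff ℝ k fun x : Fin d → ℝ => (i.insertNth c x : Fin (d + 1) → ℝ) := by
  refine contDiff_pi.2 fun j => ?_
  obtain rfl | ⟨j, rfl⟩ := Fin.eq_self_or_eq_succAbove i j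
  · simpa using contDiff_const
  · simpa using contDiff_apply ℝ ℝ j

theorem dimH_image_Icc_diff_univ_pi_Ioo_le {f : (Fin (d + 1) → ℝ) → E} (hf : ContDiff ℝ 1 f)
    (a b : Fin (d + 1) → ℝ) :
    dimH (f '' (Set.Icc a b \ Set.univ.pi fun i => Set.Ioo (a i) (b i))) ≤ d := by
  have dimH_face (i : Fin (d + 1)) (c : ℝ) :
      dimH (Set.range fun x : Fin d → ℝ => f (i.insertNth c x)) ≤ d :=
    (hf.comp (contDiff_insertNth i c)).dimH_range_le.trans (by simp)
  have hfaces : f '' (Set.Icc a b \ Set.univ.pi fun i => Set.Ioo (a i) (b i)) ⊆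
      ⋃ i : Fin (d + 1), (Set.range fun x : Fin d → ℝ => f (i.insertNth (a i) x)) ∪
        Set.range fun x : Fin d → ℝ => f (i.insertNth (b i) x) := by
    rintro _ ⟨y, ⟨hy, hy'⟩, rfl⟩
    obtain ⟨i, hi⟩ : ∃ i, y i ∉ Set.Ioo (a i) (b i) := by
      simpa only [Set.mem_univ_pi, not_forall] using hy'
    refine Set.mem_iUnion.2 ⟨i, ?_⟩
    rcases (hy.1 i).eq_or_lt with ha | ha
    · exact Or.inl ⟨i.removeNth y, by simp only [ha, Fin.insertNth_self_removeNth]⟩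
    · have hb : b i = y i := ((hy.2 i).antisymm (not_lt.1 fun hb => hi ⟨ha, hb⟩)).symm
      exact Or.inr ⟨i.removeNth y, by simp only [hb, Fin.insertNth_self_removeNth]⟩
  refine (dimH_mono hfaces).trans ?_
  rw [dimH_iUnion]
  exact iSup_le fun i => (dimH_union _ _).trans_le (max_le (dimH_face i _) (dimH_face i _))

theorem hausdorffMeasure_borel_eq_zero_of_dimH_le {X : Type*} [MetricSpace X] {s : Set X}
    (h : dimH s ≤ d) :
    @Measure.hausdorffMeasure X _ (borel X) (@BorelSpace.mk X _ (borel X) rfl) ((d + 1 : ℕ) : ℝ) s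
      = 0 := by
  let _ : MeasurableSpace X := borel X
  have _ : BorelSpace X := ⟨rfl⟩
  refine hausdorffMeasure_of_dimH_lt (d := ((d + 1 : ℕ) : NNReal)) (h.trans_lt ?_)
  exact_mod_cast d.lt_succ_self

end BoxBoundary

namespace HC

section MovedPolarCoordinates

variable {M : Matrix (Fin 2 ⊕ Fin 2) (Fin 2 ⊕ Fin 2) ℂ} {R : ℝ}

/-- Polar coordinates on `U(2)`, carried over to `U(2)_R` by a linear fractional transformation
which is to map the origin to the point at which a function is reproduced. -/
noncomputable def movedPolar (M : Matrix (Fin 2 ⊕ Fin 2) (Fin 2 ⊕ Fin 2) ℂ) (R : ℝ)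
    (y : Fin 4 → ℝ) : HC :=
  R • linFrac M (polar y)

theorem det_linFracDenom_polar_ne_zero (hM : IsPseudoUnitary M) (y : Fin 4 → ℝ) :
    (linFracDenom M (polar y)).det ≠ 0 :=
  hM.det_linFracDenom_ne_zero_of_mem_unitaryGroup (polar_mem_unitaryGroup y)

theorem contDiff_linFrac_polar (hM : IsPseudoUnitary M) :
    ContDiff ℝ 1 fun y => linFrac M (polar y) :=
  contDiff_iff_contDiffAt.2 fun y =>
    ((contDiffAt_linFrac (𝕜 := ℂ) (det_linFracDenom_polar_ne_zero hM y)).restrict_scalars ℝ).comp y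
      contDiff_polar.contDiffAt

theorem contDiff_movedPolar (hM : IsPseudoUnitary M) : ContDiff ℝ 1 (movedPolar M R) :=
  (contDiff_linFrac_polar hM).const_smul R

theorem fderiv_movedPolar (hM : IsPseudoUnitary M) (y v : Fin 4 → ℝ) :
    fderiv ℝ (movedPolar M R) y v =
      R • linFracCofactor M (polar y) * fderiv ℝ polar y v * (linFracDenom M (polar y))⁻¹ := by
  have hψ := ((contDiff_linFrac_polar hM).differentiable one_ne_zero y).hasFDerivAt.const_smul R
  refine (congrArg (· v) hψ.fderiv).trans ?_
  change R • fderiv ℝ (fun y => linFrac M (polar y)) y v = _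
  rw [fderiv_linFrac_comp (contDiff_polar.differentiable one_ne_zero y)
    (det_linFracDenom_polar_ne_zero hM y), smul_mul_assoc, smul_mul_assoc]

theorem dZ4_fderiv_movedPolar (hM : IsPseudoUnitary M) (y : Fin 4 → ℝ) :
    dZ4 (fun j => fderiv ℝ (movedPolar M R) y (Pi.single j 1)) =
      (R ^ 2 * (linFracCofactor M (polar y)).det / (linFracDenom M (polar y)).det) ^ 2 *
        (-2 * Complex.I * (Real.sin (y 3) * Real.cos (y 3) : ℝ) * (polar y).det ^ 2) := by
  simp only [fderiv_movedPolar hM]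
  rw [dZ4_mul_right _ fun j => _ * fderiv ℝ polar y (Pi.single j 1), dZ4_mul_left,
    dZ4_fderiv_polar, det_smul_of_tower, det_nonsing_inv, Ring.inverse_eq_inv', Fintype.card_fin,
    Complex.real_smul, Complex.ofReal_pow]
  ring

theorem movedPolar_mem_U2 (hM : IsPseudoUnitary M) (y : Fin 4 → ℝ) : movedPolar M R y ∈ U2 R :=
  ⟨_, hM.linFrac_mem_unitaryGroup (polar_mem_unitaryGroup y), rfl⟩

theorem movedPolar_injOn (hM : IsPseudoUnitary M) (hR : R ≠ 0) :
    Set.InjOn (movedPolar M R) polarBox :=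
  ((smul_right_injective HC hR).injOn.comp hM.linFrac_injOn_unitaryGroup (Set.mapsTo_univ _ _)).comp
    polar_injOn fun y _ => polar_mem_unitaryGroup y

theorem movedPolar_surjOn (hM : IsPseudoUnitary M) :
    Set.SurjOn (movedPolar M R) (Set.Icc 0 polarBound) (U2 R) := by
  rintro _ ⟨Z, hZ, rfl⟩
  obtain ⟨y, hy, rfl⟩ := (hM.linFrac_surjOn_unitaryGroup.comp polar_surjOn) hZ
  exact ⟨y, hy, rfl⟩

theorem U2_diff_image_movedPolar_subset (hM : IsPseudoUnitary M) :
    U2 R \ movedPolar M R '' polarBox ⊆ movedPolar M R '' (Set.Icc 0 polarBound \ polarBox) := by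
  rintro _ ⟨hZ, hZ'⟩
  obtain ⟨y, hy, rfl⟩ := movedPolar_surjOn hM hZ
  exact ⟨y, ⟨hy, fun hy' => hZ' ⟨y, hy', rfl⟩⟩, rfl⟩

theorem det_frame_matrix_pos (hM : IsPseudoUnitary M) (hR : R ≠ 0) {y : Fin 4 → ℝ}
    (hy : y ∈ polarBox) {A : Matrix (Fin 4) (Fin 4) ℝ}
    (hA : ∀ j, fderiv ℝ (movedPolar M R) y (Pi.single j 1) =
      ∑ i, A i j • frame (movedPolar M R y) i) : 0 < A.det := by
  set p := (linFrac M (polar y) * linFracDenom M (polar y)).det with hp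
  have hpk : star p * (linFracCofactor M (polar y) * polar y).det = 1 := by
    rw [hp, ← det_conjTranspose, ← det_mul,
      hM.conjTranspose_mul_linFracCofactor_mul (polar_mem_unitaryGroup y), det_one]
  have hdZ4 := dZ4_fderiv_movedPolar (R := R) hM y
  rw [funext hA, dZ4_sum_smul, dZ4_frame, movedPolar, det_smul_of_tower, Fintype.card_fin,
    Complex.real_smul, Complex.ofReal_pow] at hdZ4
  have hdetA : A.det * (2 * ‖p‖ ^ 4) = Real.sin (y 3) * Real.cos (y 3) := by
    have hnorm : star p * p = (‖p‖ : ℂ) ^ 2 := Complex.conj_mul' p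
    have hdenom := det_linFracDenom_polar_ne_zero hM y
    have hR' : (R : ℂ) ≠ 0 := Complex.ofReal_ne_zero.2 hR
    rw [det_mul] at hp hpk
    clear_value p
    field_simp at hdZ4
    have hdetA : (A.det : ℂ) * (2 * (‖p‖ : ℂ) ^ 4) = (Real.sin (y 3) * Real.cos (y 3) : ℝ) := by
      linear_combination -2 * A.det * (star p * p + (‖p‖ : ℂ) ^ 2) * hnorm
        + 2 * A.det * star p ^ 2 * (p + (linFrac M (polar y)).det * (linFracDenom M (polar y)).det)
          * hp - star p ^ 2 / 2 * hdZ4 + (Real.sin (y 3) * Real.cos (y 3) : ℝ) *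
          (star p * ((linFracCofactor M (polar y)).det * (polar y).det) + 1) * hpk
    exact_mod_cast hdetA
  obtain ⟨hsin, hcos⟩ := sin_pos_and_cos_pos_of_mem_polarBox hy
  exact pos_of_mul_pos_left (hdetA ▸ mul_pos hsin hcos) (by positivity)

theorem conjTranspose_movedPolar_mul_movedPolar (hM : IsPseudoUnitary M) (y : Fin 4 → ℝ) :
    (movedPolar M R y)ᴴ * movedPolar M R y = R ^ 2 • (1 : HC) := by
  have hψ := mem_unitaryGroup_iff'.1 (hM.linFrac_mem_unitaryGroup (polar_mem_unitaryGroup y))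
  rw [movedPolar, conjTranspose_smul, star_trivial, smul_mul_smul_comm, ← sq,
    ← star_eq_conjTranspose, hψ]

theorem exists_frame_matrix_det_pos (hM : IsPseudoUnitary M) (hR : R ≠ 0) {y : Fin 4 → ℝ}
    (hy : y ∈ polarBox) :
    ∃ A : Matrix (Fin 4) (Fin 4) ℝ, 0 < A.det ∧
      ∀ j, fderiv ℝ (movedPolar M R) y (Pi.single j 1) =
        ∑ i, A i j • frame (movedPolar M R y) i := by
  have hsq := conjTranspose_movedPolar_mul_movedPolar (R := R) hM
  have hunit : IsUnit (movedPolar M R y).det := by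
    refine isUnit_det_of_left_inverse (B := (R ^ 2)⁻¹ • (movedPolar M R y)ᴴ) ?_
    rw [smul_mul_assoc, hsq, inv_smul_smul₀ (pow_ne_zero 2 hR)]
  obtain ⟨A, hA⟩ := exists_eq_sum_smul_frame hunit fun j =>
    conjTranspose_inv_mul_fderiv (pow_ne_zero 2 hR) hsq
      ((contDiff_movedPolar hM).differentiable one_ne_zero y) (Pi.single j 1)
  exact ⟨A, det_frame_matrix_pos hM hR hy hA, hA⟩

theorem isPositiveParametrization_movedPolar (hM : IsPseudoUnitary M) (hR : R ≠ 0) :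
    IsPositiveParametrization (U2 R) frame polarBox (movedPolar M R) where
  isOpen := isOpen_set_pi Set.finite_univ fun _ _ => isOpen_Ioo
  contDiffOn := (contDiff_movedPolar hM).contDiffOn
  injOn := movedPolar_injOn hM hR
  mapsTo := fun y _ => movedPolar_mem_U2 hM y
  positive := fun _ hy => exists_frame_matrix_det_pos hM hR hy
  null_compl := hausdorffMeasure_borel_eq_zero_of_dimH_le <|
    (dimH_mono (U2_diff_image_movedPolar_subset hM)).trans
      (dimH_image_Icc_diff_univ_pi_Ioo_le (contDiff_movedPolar hM) 0 polarBound)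

end MovedPolarCoordinates

end HC

section BoxIntegral

theorem setIntegral_univ_pi_succ {n : ℕ} {E : Type*} [NormedAddCommGroup E] [NormedSpace ℝ E]
    {s : Fin (n + 1) → Set ℝ} {g : (Fin (n + 1) → ℝ) → E}
    (hg : IntegrableOn g (Set.univ.pi s)) :
    ∫ y in Set.univ.pi s, g y =
      ∫ x in Set.univ.pi fun i => s i.succ, ∫ t in s 0, g (Fin.cons t x) := by
  let μ : Fin (n + 1) → Measure ℝ := fun i => volume.restrict (s i)
  have hres : (volume : Measure (Fin (n + 1) → ℝ)).restrict (Set.univ.pi s) = Measure.pi μ := by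
    rw [volume_pi, Measure.restrict_pi_pi]
  have hmp := (measurePreserving_piFinSuccAbove μ 0).symm
  rw [IntegrableOn, hres, ← hmp.integrable_comp_emb (MeasurableEquiv.measurableEmbedding _)] at hg
  rw [hres, ← hmp.integral_comp', volume_pi, Measure.restrict_pi_pi]
  refine (integral_prod_symm _ hg).trans ?_
  have hcons (t : ℝ) (x : Fin n → ℝ) :
      (MeasurableEquiv.piFinSuccAbove (fun _ : Fin (n + 1) => ℝ) 0).symm (t, x) = Fin.cons t x := by
    simp [MeasurableEquiv.piFinSuccAbove, Fin.insertNthEquiv]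
  simp only [Function.comp_apply, hcons]
  rfl

theorem setIntegral_comp_exp_mul_I {E : Type*} [NormedAddCommGroup E] [NormedSpace ℂ E]
    [CompleteSpace E] {h : ℂ → E} (hh : DiffContOnCl ℂ h (Metric.ball 0 1)) :
    ∫ t in Set.Ioo 0 (2 * Real.pi), h (Complex.exp (t * Complex.I)) = (2 * Real.pi) • h 0 := by
  have hmean := DiffContOnCl.circleAverage (c := 0) (R := 1) (by rwa [abs_one])
  rw [← hmean, Real.circleAverage_def, smul_inv_smul₀ Real.two_pi_pos.ne',
    intervalIntegral.integral_of_le Real.two_pi_pos.le, integral_Ioc_eq_integral_Ioo]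
  simp only [circleMap_zero, Complex.ofReal_one, one_mul]

end BoxIntegral

namespace HC

section PolarIntegral

theorem integrableOn_polarBox {E : Type*} [NormedAddCommGroup E] {g : (Fin 4 → ℝ) → E}
    (hg : Continuous g) : IntegrableOn g polarBox :=
  (hg.continuousOn.integrableOn_compact (isCompact_Icc (a := 0) (b := polarBound))).mono_set
    fun _ hy => ⟨fun i => (mem_polarBox.1 hy i).1.le, fun i => (mem_polarBox.1 hy i).2.le⟩

theorem setIntegral_sin_mul_cos :
    ∫ x in Set.univ.pi fun i : Fin 3 => Set.Ioo 0 (polarBound i.succ),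
      Real.sin (x 2) * Real.cos (x 2) = 2 * Real.pi ^ 2 := by
  have hprod (x : Fin 3 → ℝ) : Real.sin (x 2) * Real.cos (x 2) =
      ∏ i, (![fun _ => 1, fun _ => 1, fun t => Real.sin t * Real.cos t] : Fin 3 → ℝ → ℝ)
        i (x i) := by
    simp [Fin.prod_univ_three]
  have hcircle : ∫ _ in Set.Ioo 0 (2 * Real.pi), (1 : ℝ) = 2 * Real.pi := by
    simp [Real.pi_nonneg]
  have hlast : ∫ t in Set.Ioo 0 (Real.pi / 2), Real.sin t * Real.cos t = 1 / 2 := by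
    rw [← integral_Ioc_eq_integral_Ioo, ← intervalIntegral.integral_of_le (by positivity),
      integral_sin_mul_cos₁]
    simp
  simp only [hprod]
  rw [volume_pi, Measure.restrict_pi_pi, integral_fin_nat_prod_eq_prod, Fin.prod_univ_three]
  refine (congrArg₂ _ (congrArg₂ _ hcircle hcircle) hlast).trans ?_
  ring

theorem setIntegral_polarBox {h : HC → ℂ} (hh : Continuous fun y => h (polar y))
    (hcirc : ∀ Q ∈ unitaryGroup (Fin 2) ℂ,
      DiffContOnCl ℂ (fun z : ℂ => h (z • Q)) (Metric.ball 0 1)) :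
    ∫ y in polarBox, ((Real.sin (y 3) * Real.cos (y 3) : ℝ) : ℂ) * h (polar y) =
      4 * Real.pi ^ 3 * h 0 := by
  have hcont : Continuous fun y : Fin 4 → ℝ =>
      ((Real.sin (y 3) * Real.cos (y 3) : ℝ) : ℂ) * h (polar y) :=
    Continuous.mul (by fun_prop) hh
  rw [polarBox, setIntegral_univ_pi_succ (integrableOn_polarBox hcont)]
  have hinner (x : Fin 3 → ℝ) : ∫ t in Set.Ioo 0 (polarBound 0),
      ((Real.sin ((Fin.cons t x : Fin 4 → ℝ) 3) * Real.cos ((Fin.cons t x : Fin 4 → ℝ) 3) : ℝ) : ℂ)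
        * h (polar (Fin.cons t x)) =
      ((Real.sin (x 2) * Real.cos (x 2) : ℝ) : ℂ) * (2 * Real.pi * h 0) := by
    have hQ : phase (x 1) * rotation (x 2) * phase (x 0) ∈ unitaryGroup (Fin 2) ℂ :=
      mul_mem (mul_mem (phase_mem_unitaryGroup _) (rotation_mem_unitaryGroup _))
        (phase_mem_unitaryGroup _)
    have hmean := setIntegral_comp_exp_mul_I (hcirc _ hQ)
    rw [zero_smul, Complex.real_smul, Complex.ofReal_mul, Complex.ofReal_ofNat] at hmean
    rw [← hmean]
    exact integral_const_mul ((Real.sin (x 2) * Real.cos (x 2) : ℝ) : ℂ) _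
  simp only [hinner]
  rw [integral_mul_const, integral_complex_ofReal, setIntegral_sin_mul_cos]
  push_cast
  ring

end PolarIntegral

section Reproduction

variable {M : Matrix (Fin 2 ⊕ Fin 2) (Fin 2 ⊕ Fin 2) ℂ} {F : HC → ℂ} {R : ℝ}

/-- What is left of `F(Z) / N(Z - W)²` after the substitution `Z ↦ R ψ(Z)`, where `ψ = linFrac M`
and `W = R ψ(0)`: the Jacobian of the substitution cancels the kernel up to an automorphy factor,
which is holomorphic in the ball and equal to `1` at the origin. -/
noncomputable def weightedPullback (F : HC → ℂ) (M : Matrix (Fin 2 ⊕ Fin 2) (Fin 2 ⊕ Fin 2) ℂ)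
    (R : ℝ) (Z : HC) : ℂ :=
  F (R • linFrac M Z) * ((linFracDenom M 0).det / (linFracDenom M Z).det) ^ 2

theorem det_linFracDenom_zero_ne_zero (hM : IsPseudoUnitary M) : (linFracDenom M 0).det ≠ 0 :=
  hM.det_linFracDenom_ne_zero <| by
    rw [Matrix.mul_zero, sub_zero]
    exact PosSemidef.one

theorem weightedPullback_zero (hM : IsPseudoUnitary M) :
    weightedPullback F M R 0 = F (R • linFrac M 0) := by
  rw [weightedPullback, div_self (det_linFracDenom_zero_ne_zero hM), one_pow, mul_one]

theorem N_movedPolar_sub (hM : IsPseudoUnitary M) (y : Fin 4 → ℝ) :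
    N (movedPolar M R y - R • linFrac M 0) =
      R ^ 2 * ((linFracCofactor M (polar y)).det * (polar y).det / (linFracDenom M 0).det) := by
  rw [N, movedPolar, ← smul_sub, ← neg_sub, linFrac_sub_linFrac
    (det_linFracDenom_polar_ne_zero hM y).isUnit (det_linFracDenom_zero_ne_zero hM).isUnit,
    zero_sub, mul_neg, neg_mul, neg_neg, det_smul_of_tower, det_mul, det_mul, det_nonsing_inv,
    Ring.inverse_eq_inv', Fintype.card_fin, Complex.real_smul, Complex.ofReal_pow, div_eq_mul_inv]

theorem pullbackCoeff_movedPolar (hM : IsPseudoUnitary M) (hR : R ≠ 0) (y : Fin 4 → ℝ) :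
    pullbackCoeff (fun Z => (F Z / N (Z - R • linFrac M 0) ^ 2) • dZ4) (movedPolar M R) y =
      -2 * Complex.I *
        ((Real.sin (y 3) * Real.cos (y 3) : ℝ) * weightedPullback F M R (polar y)) := by
  have hcof_mul := isUnit_det_of_left_inverse
    (hM.conjTranspose_mul_linFracCofactor_mul (polar_mem_unitaryGroup y))
  rw [det_mul] at hcof_mul
  obtain ⟨hcof, hpolar⟩ := mul_ne_zero_iff.1 hcof_mul.ne_zero
  have hdenom := det_linFracDenom_polar_ne_zero hM y
  have hdenom0 := det_linFracDenom_zero_ne_zero hM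
  have hR' : (R : ℂ) ≠ 0 := Complex.ofReal_ne_zero.2 hR
  change F (movedPolar M R y) / N (movedPolar M R y - R • linFrac M 0) ^ 2 *
    dZ4 (fun j => fderiv ℝ (movedPolar M R) y (Pi.single j 1)) = _
  rw [N_movedPolar_sub hM, dZ4_fderiv_movedPolar hM, weightedPullback, movedPolar]
  field_simp

theorem smul_linFrac_smul_mem_matrixBall (hM : IsPseudoUnitary M) (hR : R ≠ 0) {Q : HC}
    (hQ : Q ∈ unitaryGroup (Fin 2) ℂ) {z : ℂ} (hz : z ∈ Metric.ball 0 1) :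
    R • linFrac M (z • Q) ∈ matrixBall (Fin 2) R :=
  (smul_mem_matrixBall_iff hR).2 <|
    hM.posDef_one_sub_linFrac (posDef_one_sub_smul hQ (mem_ball_zero_iff.1 hz))

theorem diffContOnCl_weightedPullback (hF : DiffContOnCl ℂ F (matrixBall (Fin 2) R))
    (hM : IsPseudoUnitary M) (hR : R ≠ 0) {Q : HC} (hQ : Q ∈ unitaryGroup (Fin 2) ℂ) :
    DiffContOnCl ℂ (fun z : ℂ => weightedPullback F M R (z • Q)) (Metric.ball 0 1) := by
  have hdenom {z : ℂ} (hz : z ∈ closure (Metric.ball 0 1)) : (linFracDenom M (z • Q)).det ≠ 0 := by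
    rw [closure_ball _ one_ne_zero] at hz
    exact hM.det_linFracDenom_ne_zero (posSemidef_one_sub_smul hQ (mem_closedBall_zero_iff.1 hz))
  have hline : Differentiable ℂ fun z : ℂ => z • Q := differentiable_id.smul_const Q
  have hψ : DifferentiableOn ℂ (fun z : ℂ => R • linFrac M (z • Q))
      (closure (Metric.ball 0 1)) := fun z hz =>
    (((contDiffAt_linFrac (k := 1) (hdenom hz)).differentiableAt one_ne_zero).comp z
      (hline z)).const_smul R |>.differentiableWithinAt
  have hdet : DifferentiableOn ℂ (fun z : ℂ => (linFracDenom M (z • Q)).det)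
      (closure (Metric.ball 0 1)) :=
    ((contDiff_matrix_det.comp contDiff_linFracDenom).differentiable (n := 1) one_ne_zero).comp
      hline |>.differentiableOn
  exact (hF.comp hψ.diffContOnCl fun z hz => smul_linFrac_smul_mem_matrixBall hM hR hQ hz).smul
    (((differentiableOn_const _).div hdet fun z hz => hdenom hz).pow 2).diffContOnCl

theorem U2_subset_closure_matrixBall (hR : R ≠ 0) : U2 R ⊆ closure (matrixBall (Fin 2) R) := by
  rintro _ ⟨U, hU, rfl⟩
  have hmaps : Set.MapsTo (fun z : ℂ => R • z • U) (Metric.ball 0 1) (matrixBall (Fin 2) R) :=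
    fun z hz =>
      (smul_mem_matrixBall_iff hR).2 (posDef_one_sub_smul hU (mem_ball_zero_iff.1 hz))
  have hone : (1 : ℂ) ∈ closure (Metric.ball 0 1) := by simp [closure_ball]
  simpa using hmaps.closure (by fun_prop) hone

theorem continuous_weightedPullback_polar (hF : ContinuousOn F (closure (matrixBall (Fin 2) R)))
    (hM : IsPseudoUnitary M) (hR : R ≠ 0) :
    Continuous fun y => weightedPullback F M R (polar y) := by
  have hFψ : Continuous fun y => F (movedPolar M R y) :=
    hF.comp_continuous (contDiff_movedPolar hM).continuous fun y =>
      U2_subset_closure_matrixBall hR (movedPolar_mem_U2 hM y)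
  have hdet : Continuous fun y => (linFracDenom M (polar y)).det :=
    ((contDiff_matrix_det (k := 0)).comp (contDiff_linFracDenom (𝕜 := ℂ))).continuous.comp
      contDiff_polar.continuous
  exact hFψ.mul ((continuous_const.div hdet (det_linFracDenom_polar_ne_zero hM)).pow 2)

theorem hasFormIntegral_U2 (hF : DiffContOnCl ℂ F (matrixBall (Fin 2) R))
    (hM : IsPseudoUnitary M) (hR : R ≠ 0) :
    HasFormIntegral (U2 R) frame (fun Z => (F Z / N (Z - R • linFrac M 0) ^ 2) • dZ4)
      (-8 * Complex.I * Real.pi ^ 3 * F (R • linFrac M 0)) := by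
  have hpull := funext (pullbackCoeff_movedPolar (F := F) hM hR)
  have hcont := continuous_weightedPullback_polar hF.continuousOn hM hR
  refine ⟨polarBox, movedPolar M R, isPositiveParametrization_movedPolar hM hR, ?_, ?_⟩
  · rw [hpull]
    exact integrableOn_polarBox (by fun_prop)
  · rw [hpull, integral_const_mul, setIntegral_polarBox hcont fun Q hQ =>
      diffContOnCl_weightedPullback hF hM hR hQ, weightedPullback_zero hM]
    ring

end Reproduction

section Quaternions

theorem differentiable_evalPoly (F : MvPolynomial (Fin 2 × Fin 2) ℂ) :
    Differentiable ℂ (evalPoly F) := by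
  unfold evalPoly
  induction F using MvPolynomial.induction_on with
  | C a => simp
  | add p q hp hq =>
    simp only [map_add]
    exact hp.add hq
  | mul_X p n hp =>
    simp only [map_mul, MvPolynomial.eval_X]
    exact hp.mul ((contDiff_apply_apply ℂ ℂ n.1 n.2).differentiable one_ne_zero)

theorem conjTranspose_ofQuaternion_mul_self (W : ℍ[ℝ]) :
    (ofQuaternion W)ᴴ * ofQuaternion W = Quaternion.normSq W • (1 : HC) := by
  rw [Quaternion.normSq_def', ofQuaternion]
  ext i j
  fin_cases i <;> fin_cases j <;>
    simp [basisM, mul_apply, Fin.sum_univ_two, Complex.ext_iff, sq] <;> constructor <;> ring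

theorem ofQuaternion_mem_matrixBall {R : ℝ} {W : ℍ[ℝ]} (hW : Quaternion.normSq W < R ^ 2) :
    ofQuaternion W ∈ matrixBall (Fin 2) R := by
  rw [matrixBall, Set.mem_ofPred_eq, conjTranspose_ofQuaternion_mul_self, ← sub_smul]
  exact PosDef.one.smul (sub_pos.2 hW)

end Quaternions

end HC

theorem mainTheorem2_general {F : HC → ℂ} {R : ℝ} {W : HC}
    (hF : DiffContOnCl ℂ F (matrixBall (Fin 2) R)) (hW : W ∈ matrixBall (Fin 2) R) :
    ∃ I : ℂ,
      HasFormIntegral (HC.U2 R) HC.frame (fun Z => (F Z / HC.N (Z - W) ^ 2) • HC.dZ4) I ∧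
      F W = Complex.I / (8 * (Real.pi : ℂ) ^ 3) * I := by
  have hR : R ≠ 0 := ne_zero_of_mem_matrixBall hW
  obtain ⟨w, rfl⟩ : ∃ w : HC, R • w = W := ⟨R⁻¹ • W, smul_inv_smul₀ hR W⟩
  obtain ⟨M, hM, rfl⟩ :=
    exists_isPseudoUnitary_linFrac_zero_eq ((smul_mem_matrixBall_iff hR).1 hW)
  refine ⟨_, HC.hasFormIntegral_U2 hF hM hR, ?_⟩
  have hpi : (Real.pi : ℂ) ≠ 0 := Complex.ofReal_ne_zero.2 Real.pi_ne_zero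
  field_simp
  linear_combination F (R • linFrac M 0) * Complex.I_sq

theorem mainTheorem2 (F : MvPolynomial (Fin 2 × Fin 2) ℂ) (R : ℝ) (hR : 0 < R)
    (W : ℍ[ℝ]) (hW : Quaternion.normSq W < R ^ 2) :
    ∃ I : ℂ,
      HasFormIntegral (HC.U2 R) HC.frame
        (fun Z => (HC.evalPoly F Z / HC.N (Z - HC.ofQuaternion W) ^ 2) • HC.dZ4) I ∧
      HC.evalPoly F (HC.ofQuaternion W) = Complex.I / (8 * (Real.pi : ℂ) ^ 3) * I :=
  mainTheorem2_general (HC.differentiable_evalPoly F).diffContOnCl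
    (HC.ofQuaternion_mem_matrixBall hW)
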